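/- Let $G$ be a compact topological group with Haar measure $dg$ of total mass $1$. A function $\phi:G\to\mathbb C$ is called positive definite if $\sum_{i,j=1}^m \phi(g_i^{-1}g_j)\,\overline{\xi_i}\,\xi_j$ is real and $\ge 0$ for all $m$, all $g_1,\dots,g_m\in G$ and all $\xi_1,\dots,\xi_m\in\mathbb C$. Let $\sigma\in\widehat G$ be an equivalence class of irreducible continuous unitary representations of $G$, represented by $D^\sigma$ acting on a finite-dimensional complex Hilbert space $H_\sigma$, and put $\dim\sigma=\dim H_\sigma$. For a continuous function $\phi:G\to\mathbb C$ set $$\widehat\phi(\sigma)=\sqrt{\dim\sigma}\int_G \phi(g)\,D^\sigma(g^{-1})\,dg\,,\qquad \phi^\sigma(g)=\sqrt{\dim\sigma}\;\mathrm{tr}\bigl(\widehat\phi(\sigma)D^\sigma(g)\bigr)\quad(g\in G),$$ so that $\widehat\phi(\sigma)$ is a linear operator on $H_\sigma$ and $\phi^\sigma:G\to\mathbb C$ is the $\sigma$-isotypical component of $\phi$. Let $\phi$ be a continuous positive definite function on $G$ and let $\sigma\in\widehat G$. Then: (a) the operator $\widehat\phi(\sigma):H_\sigma\to H_\sigma$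 is Hermitian and positive semidefinite; (b) the function $\phi^\sigma$ is again positive definite. -/

import Mathlib

open MeasureTheory
open scoped ComplexOrder ComplexConjugate

noncomputable section

/-- A function `φ : G → ℂ` on a group is positive definite if
`∑ i j, φ (g i⁻¹ g j) conj (ξ i) (ξ j)` is a nonnegative real number for all finite families
`g` in `G` and `ξ` in `ℂ` (`0 ≤ z` in `ℂ` means that `z` is real and nonnegative). -/
def IsPositiveDefiniteFun {G : Type*} [Group G] (φ : G → ℂ) : Prop :=
  ∀ (m : ℕ) (g : Fin m → G) (ξ : Fin m → ℂ),
    0 ≤ ∑ i, ∑ j, φ ((g i)⁻¹ * g j) * conj (ξ i) * ξ j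

/-- The linear representation underlying a homomorphism into the unitary group of `H`. -/
def unitaryHomToRep {G H : Type*} [Group G] [NormedAddCommGroup H] [InnerProductSpace ℂ H]
    (D : G →* (H ≃ₗᵢ[ℂ] H)) : Representation ℂ G H where
  toFun g := (D g).toLinearEquiv.toLinearMap
  map_one' := by ext v; simp
  map_mul' g h := by ext v; simp

/-- An irreducible (strongly continuous) unitary representation of `G` on `H`. -/
structure IrredUnitaryRep (G H : Type*) [Group G] [TopologicalSpace G]
    [NormedAddCommGroup H] [InnerProductSpace ℂ H] where
  /-- The homomorphism into the unitary group of `H`. -/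
  toHom : G →* (H ≃ₗᵢ[ℂ] H)
  continuous_orbit : ∀ v : H, Continuous fun g => toHom g v
  irreducible : (unitaryHomToRep toHom).IsIrreducible

namespace IrredUnitaryRep

variable {G H : Type*} [Group G] [TopologicalSpace G]
  [NormedAddCommGroup H] [InnerProductSpace ℂ H]

/-- The operator `D(g)` on `H`. -/
def op (D : IrredUnitaryRep G H) (g : G) : H →L[ℂ] H :=
  (D.toHom g).toContinuousLinearEquiv.toContinuousLinearMap

/-- The Fourier coefficient `√(dim σ) ∫ f(g) D(g⁻¹) dg`, an operator on `H`. -/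
def fourierCoeff [MeasurableSpace G] (D : IrredUnitaryRep G H) (μ : Measure G) (f : G → ℂ) :
    H →L[ℂ] H :=
  (Real.sqrt (Module.finrank ℂ H) : ℂ) • ∫ g, f g • D.op g⁻¹ ∂μ

/-- The `σ`-component `g ↦ √(dim σ) tr(f̂(σ) D(g))` of `f`. -/
def component [MeasurableSpace G] (D : IrredUnitaryRep G H) (μ : Measure G) (f : G → ℂ) :
    G → ℂ := fun g =>
  (Real.sqrt (Module.finrank ℂ H) : ℂ) *
    LinearMap.trace ℂ H ((D.fourierCoeff μ f ∘L D.op g : H →L[ℂ] H) : H →ₗ[ℂ] H)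

end IrredUnitaryRep

end

open MeasureTheory
open scoped ComplexOrder ComplexConjugate

/-! For (a), `⟨v, φ̂(σ)v⟩` is a nonnegative multiple of `∫ φ(g)⟨v, D(g⁻¹)v⟩ dg`. By left invariance
and total mass one this equals `∬ φ(x⁻¹y)⟨D(y)v, D(x)v⟩ dx dy`, a limit of finite sums; expanding
the inner product in an orthonormal basis makes each sum a sum of positive definite forms of `φ`.
For (b), with `A = φ̂(σ) ≥ 0` and `B = ∑ ξⱼ D(gⱼ)`, the form of `g ↦ tr(A D(g))` is `tr(A B* B) =
tr(B A B*) ≥ 0`. -/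

/-- A continuous map from a compact space to a pseudometric space is uniformly approximated by its
compositions with simple functions. -/
theorem exists_simpleFunc_dist_lt {X M : Type*} [TopologicalSpace X] [CompactSpace X] [Nonempty X]
    [MeasurableSpace X] [OpensMeasurableSpace X] [PseudoMetricSpace M] {f : X → M}
    (hf : Continuous f) {ε : ℝ} (hε : 0 < ε) :
    ∃ s : SimpleFunc X X, ∀ x, dist (f x) (f (s x)) < ε := by
  classical
  have hopen (c : X) : IsOpen {x | dist (f x) (f c) < ε} :=
    isOpen_lt (hf.dist continuous_const) continuous_const
  -- Induction on the finite set of centres selects a centre measurably.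
  have key (t : Finset X) :
      ∃ s : SimpleFunc X X, ∀ x, ∀ c ∈ t, dist (f x) (f c) < ε → dist (f x) (f (s x)) < ε := by
    induction t using Finset.induction_on with
    | empty => exact ⟨SimpleFunc.const X (Classical.arbitrary X), by simp⟩
    | insert a t _ ih =>
      obtain ⟨s, hs⟩ := ih
      refine ⟨SimpleFunc.piecewise _ (hopen a).measurableSet (SimpleFunc.const X a) s, ?_⟩
      intro x c hc hxc
      rw [SimpleFunc.piecewise_apply]
      split_ifs with hxa
      · exact hxa
      · rcases Finset.mem_insert.1 hc with rfl | hc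
        · exact absurd hxc hxa
        · exact hs x c hc hxc
  obtain ⟨t, ht⟩ := CompactSpace.elim_nhds_subcover (fun c : X => {x | dist (f x) (f c) < ε})
    fun c => (hopen c).mem_nhds (by simpa using hε)
  obtain ⟨s, hs⟩ := key t
  refine ⟨s, fun x => ?_⟩
  have hx : x ∈ ⋃ c ∈ t, {x | dist (f x) (f c) < ε} := ht ▸ Set.mem_univ x
  obtain ⟨c, hc, hxc⟩ := Set.mem_iUnion₂.1 hx
  exact hs x c hc hxc

/-- A continuous kernel on a compact space is uniformly approximated by simple kernels. -/
theorem exists_simpleFunc_norm_kernel_sub_lt {X : Type*} [TopologicalSpace X] [CompactSpace X]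
    [Nonempty X] [MeasurableSpace X] [OpensMeasurableSpace X] {K : X → X → ℂ}
    (hK : Continuous fun p : X × X => K p.1 p.2) {ε : ℝ} (hε : 0 < ε) :
    ∃ s : SimpleFunc X X, ∀ x y, ‖K x y - K (s x) (s y)‖ < ε := by
  -- Both partial maps of `K` are continuous into the sup norm, so one `s` serves both variables at
  -- cost `ε / 2` each. No measurability on `X × X` is needed.
  let F : C(X, C(X, ℂ)) := ContinuousMap.curry ⟨fun p : X × X => K p.1 p.2, hK⟩
  let Fswap : C(X, C(X, ℂ)) :=
    ContinuousMap.curry ⟨fun p : X × X => K p.2 p.1, hK.comp continuous_swap⟩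
  obtain ⟨s, hs⟩ := exists_simpleFunc_dist_lt (F.continuous.prodMk Fswap.continuous) (half_pos hε)
  refine ⟨s, fun x y => ?_⟩
  have h₁ : dist (K x y) (K (s x) y) < ε / 2 :=
    (ContinuousMap.dist_apply_le_dist (f := F x) (g := F (s x)) y).trans_lt
      ((le_max_left _ _).trans_lt (hs x))
  have h₂ : dist (K (s x) y) (K (s x) (s y)) < ε / 2 :=
    (ContinuousMap.dist_apply_le_dist (f := Fswap y) (g := Fswap (s y)) (s x)).trans_lt
      ((le_max_right _ _).trans_lt (hs y))
  rw [← dist_eq_norm]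
  linarith [dist_triangle (K x y) (K (s x) y) (K (s x) (s y))]

theorem MeasureTheory.SimpleFunc.integral_comp_eq_sum {X Y E : Type*} [MeasurableSpace X]
    [NormedAddCommGroup E] [NormedSpace ℝ E] [CompleteSpace E] (μ : Measure X) [IsFiniteMeasure μ]
    (s : SimpleFunc X Y) (f : Y → E) :
    ∫ x, f (s x) ∂μ = ∑ a ∈ s.range, μ.real (s ⁻¹' {a}) • f a := by
  classical
  have h (x : X) : f (s x) = ∑ a ∈ s.range, (s ⁻¹' {a}).indicator (fun _ => f a) x := by
    rw [Finset.sum_eq_single (s x)]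
    · simp
    · intro b _ hb
      simp [Set.indicator, Ne.symm hb]
    · intro hx
      exact absurd (s.mem_range_self x) hx
  simp_rw [h]
  rw [integral_finsetSum _ fun a _ =>
    (integrable_const (f a)).indicator (s.measurableSet_fiber a)]
  exact Finset.sum_congr rfl fun a _ => by
    rw [integral_indicator_const _ (s.measurableSet_fiber a)]

/-- If a continuous kernel on a compact space has nonnegative sums against nonnegative weights, so
is its double integral. -/
theorem integral_integral_nonneg_of_sum_nonneg {X : Type*} [TopologicalSpace X] [CompactSpace X]
    [Nonempty X] [MeasurableSpace X] [OpensMeasurableSpace X] (μ : Measure X)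
    [IsProbabilityMeasure μ] {K : X → X → ℂ} (hK : Continuous fun p : X × X => K p.1 p.2)
    (hpos : ∀ (t : Finset X) (c : X → ℝ), 0 ≤ ∑ x ∈ t, ∑ y ∈ t, (c x : ℂ) * c y * K x y) :
    0 ≤ ∫ x, ∫ y, K x y ∂μ ∂μ := by
  have hinner (x : X) : Integrable (K x) μ :=
    (hK.comp (Continuous.prodMk_right x)).integrable_of_hasCompactSupport
      (HasCompactSupport.of_compactSpace _)
  have hcont : Continuous fun x => ∫ y, K x y ∂μ := by
    have := continuousOn_integral_of_compact_support (μ := μ) (f := K) (s := Set.univ)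
      isCompact_univ hK.continuousOn (by simp)
    simpa [continuousOn_univ] using this
  have hout : Integrable (fun x => ∫ y, K x y ∂μ) μ :=
    hcont.integrable_of_hasCompactSupport (HasCompactSupport.of_compactSpace _)
  -- Simple kernels integrate to weighted sums covered by `hpos`, and the nonnegative cone is
  -- closed.
  have hmem : (∫ x, ∫ y, K x y ∂μ ∂μ) ∈ closure (Set.Ici (0 : ℂ)) := by
    refine Metric.mem_closure_iff.2 fun ε hε => ?_
    obtain ⟨s, hs⟩ := exists_simpleFunc_norm_kernel_sub_lt hK (half_pos hε)
    have hsint (f : X → ℂ) : Integrable (fun x => f (s x)) μ :=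
      SimpleFunc.integrable_of_isFiniteMeasure (s.map f)
    refine ⟨∫ x, ∫ y, K (s x) (s y) ∂μ ∂μ, ?_, ?_⟩
    · rw [SimpleFunc.integral_comp_eq_sum μ s fun a => ∫ y, K a (s y) ∂μ]
      simp_rw [SimpleFunc.integral_comp_eq_sum μ s, Finset.smul_sum]
      refine (hpos s.range fun a => μ.real (s ⁻¹' {a})).trans_eq ?_
      simp [mul_assoc]
    · rw [dist_eq_norm, ← integral_sub hout (hsint fun a => ∫ y, K a (s y) ∂μ)]
      refine (norm_integral_le_of_norm_le_const (C := ε / 2) (.of_forall fun x => ?_)).trans_lt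
        (by simpa using half_lt_self hε)
      rw [← integral_sub (hinner x) (hsint (K (s x)))]
      refine (norm_integral_le_of_norm_le_const (C := ε / 2)
        (.of_forall fun y => (hs x y).le)).trans_eq (by simp)
  rwa [isClosed_Ici.closure_eq] at hmem

theorem IsPositiveDefiniteFun.finset_sum_nonneg {G : Type*} [Group G] {φ : G → ℂ}
    (h : IsPositiveDefiniteFun φ) (t : Finset G) (ξ : G → ℂ) :
    0 ≤ ∑ x ∈ t, ∑ y ∈ t, φ (x⁻¹ * y) * conj (ξ x) * ξ y := by
  refine (h t.card (fun i => t.equivFin.symm i) fun i => ξ (t.equivFin.symm i)).trans_eq ?_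
  rw [← Finset.sum_coe_sort t, ← t.equivFin.symm.sum_comp]
  refine Finset.sum_congr rfl fun i _ => ?_
  rw [← Finset.sum_coe_sort t, ← t.equivFin.symm.sum_comp]

namespace IrredUnitaryRep

variable {G H : Type*} [Group G] [TopologicalSpace G]
  [NormedAddCommGroup H] [InnerProductSpace ℂ H]

@[simp]
theorem op_apply (D : IrredUnitaryRep G H) (g : G) (v : H) : D.op g v = D.toHom g v := rfl

theorem op_mul (D : IrredUnitaryRep G H) (g h : G) : D.op (g * h) = D.op g ∘L D.op h := by
  ext v
  simp

theorem inner_op_inv_left (D : IrredUnitaryRep G H) (g : G) (v w : H) :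
    inner ℂ (D.op g⁻¹ v) w = inner ℂ v (D.op g w) := by
  rw [← (D.toHom g).inner_map_map]
  simp

theorem adjoint_op [CompleteSpace H] (D : IrredUnitaryRep G H) (g : G) :
    ContinuousLinearMap.adjoint (D.op g) = D.op g⁻¹ :=
  ((ContinuousLinearMap.eq_adjoint_iff _ _).2 fun v w => D.inner_op_inv_left g v w).symm

theorem continuous_op [FiniteDimensional ℂ H] (D : IrredUnitaryRep G H) : Continuous D.op :=
  continuous_clm_apply.2 D.continuous_orbit

/-- A Schur product argument: the Gram kernel `⟨D(y)v, D(x)v⟩` splits over a basis into rank-one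
kernels, each absorbed into the weights `ξ`. -/
theorem finset_sum_matrixCoeff_nonneg [FiniteDimensional ℂ H] (D : IrredUnitaryRep G H)
    {φ : G → ℂ} (hpos : IsPositiveDefiniteFun φ) (v : H) (t : Finset G) (c : G → ℝ) :
    0 ≤ ∑ x ∈ t, ∑ y ∈ t,
      (c x : ℂ) * c y * (φ (x⁻¹ * y) * inner ℂ v (D.op (x⁻¹ * y)⁻¹ v)) := by
  let b := stdOrthonormalBasis ℂ H
  have key (x y : G) : inner ℂ v (D.op (x⁻¹ * y)⁻¹ v) =
      ∑ i, inner ℂ (D.op y v) (b i) * inner ℂ (b i) (D.op x v) := by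
    rw [b.sum_inner_mul_inner, mul_inv_rev, inv_inv, op_mul, ContinuousLinearMap.comp_apply,
      ← D.inner_op_inv_left y⁻¹, inv_inv]
  have hsum : ∑ x ∈ t, ∑ y ∈ t,
      (c x : ℂ) * c y * (φ (x⁻¹ * y) * inner ℂ v (D.op (x⁻¹ * y)⁻¹ v)) =
      ∑ i, ∑ x ∈ t, ∑ y ∈ t, φ (x⁻¹ * y) * conj ((c x : ℂ) * inner ℂ (D.op x v) (b i)) *
        ((c y : ℂ) * inner ℂ (D.op y v) (b i)) := by
    rw [Finset.sum_comm]
    simp_rw [key, Finset.mul_sum]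
    rw [Finset.sum_comm]
    conv_rhs => rw [Finset.sum_comm]
    refine Finset.sum_congr rfl fun x _ => ?_
    rw [Finset.sum_comm]
    refine Finset.sum_congr rfl fun i _ => Finset.sum_congr rfl fun y _ => ?_
    rw [map_mul, Complex.conj_ofReal, inner_conj_symm]
    ring
  rw [hsum]
  exact Finset.sum_nonneg fun i _ =>
    hpos.finset_sum_nonneg t fun x => (c x : ℂ) * inner ℂ (D.op x v) (b i)

theorem integral_matrixCoeff_nonneg [FiniteDimensional ℂ H] [IsTopologicalGroup G] [CompactSpace G]
    [MeasurableSpace G] [BorelSpace G] (D : IrredUnitaryRep G H) (μ : Measure G)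
    [μ.IsMulLeftInvariant] [IsProbabilityMeasure μ] {φ : G → ℂ} (hcont : Continuous φ)
    (hpos : IsPositiveDefiniteFun φ) (v : H) :
    0 ≤ ∫ g, φ g * inner ℂ v (D.op g⁻¹ v) ∂μ := by
  have hψ : Continuous fun g => φ g * inner ℂ v (D.op g⁻¹ v) :=
    hcont.mul (continuous_const.inner ((D.continuous_orbit v).comp continuous_inv))
  have h := integral_integral_nonneg_of_sum_nonneg μ
    (K := fun x y => φ (x⁻¹ * y) * inner ℂ v (D.op (x⁻¹ * y)⁻¹ v))
    (hψ.comp (continuous_fst.inv.mul continuous_snd)) (D.finset_sum_matrixCoeff_nonneg hpos v)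
  -- The inner integral does not depend on `x`, so the outer one is trivial.
  simp_rw [fun x : G => integral_mul_left_eq_self (μ := μ)
    (fun g => φ g * inner ℂ v (D.op g⁻¹ v)) x⁻¹] at h
  simpa using h

theorem inner_fourierCoeff [FiniteDimensional ℂ H] [IsTopologicalGroup G] [CompactSpace G]
    [MeasurableSpace G] [BorelSpace G] (D : IrredUnitaryRep G H) (μ : Measure G)
    [IsFiniteMeasure μ] {φ : G → ℂ} (hcont : Continuous φ) (v : H) :
    inner ℂ v (D.fourierCoeff μ φ v) =
      (Real.sqrt (Module.finrank ℂ H) : ℂ) * ∫ g, φ g * inner ℂ v (D.op g⁻¹ v) ∂μ := by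
  have hinner : Integrable (fun g => φ g • D.op g⁻¹) μ :=
    (hcont.smul (D.continuous_op.comp continuous_inv)).integrable_of_hasCompactSupport
      (HasCompactSupport.of_compactSpace _)
  have : CompleteSpace H := FiniteDimensional.complete ℂ H
  rw [fourierCoeff, smul_apply, inner_smul_right,
    ContinuousLinearMap.integral_apply hinner, ← integral_inner (hinner.apply_continuousLinearMap v)]
  simp_rw [smul_apply, inner_smul_right]

theorem fourierCoeff_isPositive [FiniteDimensional ℂ H] [IsTopologicalGroup G] [CompactSpace G]
    [MeasurableSpace G] [BorelSpace G] (D : IrredUnitaryRep G H) (μ : Measure G)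
    [μ.IsMulLeftInvariant] [IsProbabilityMeasure μ] {φ : G → ℂ} (hcont : Continuous φ)
    (hpos : IsPositiveDefiniteFun φ) : (D.fourierCoeff μ φ).IsPositive := by
  refine (ContinuousLinearMap.isPositive_iff_complex _).2 fun v => ?_
  have h : 0 ≤ inner ℂ v (D.fourierCoeff μ φ v) := by
    rw [D.inner_fourierCoeff μ hcont]
    exact mul_nonneg (by simp) (D.integral_matrixCoeff_nonneg μ hcont hpos v)
  rw [Complex.nonneg_iff] at h
  rw [← inner_conj_symm]
  refine ⟨Complex.ext (Complex.ofReal_re _) ?_, ?_⟩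
  · rw [Complex.ofReal_im, Complex.conj_im, ← h.2, neg_zero]
  · exact h.1.trans_eq (Complex.conj_re _).symm

/-- The functions `g ↦ tr (A D(g))` with `A` positive are positive definite. -/
theorem isPositiveDefiniteFun_trace_comp_op [FiniteDimensional ℂ H] (D : IrredUnitaryRep G H)
    {A : H →L[ℂ] H} (hA : A.IsPositive) :
    IsPositiveDefiniteFun fun g => LinearMap.trace ℂ H ((A ∘L D.op g : H →L[ℂ] H) : H →ₗ[ℂ] H) := by
  intro m g ξ
  have : CompleteSpace H := FiniteDimensional.complete ℂ H
  -- Since `D(g)* = D(g⁻¹)`, expanding `B* B` produces the operators `D(gᵢ⁻¹gⱼ)`.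
  let B : H →L[ℂ] H := ∑ j, ξ j • D.op (g j)
  have hB : ContinuousLinearMap.adjoint B = ∑ i, conj (ξ i) • D.op (g i)⁻¹ := by
    rw [map_sum]
    exact Finset.sum_congr rfl fun i _ => by rw [map_smulₛₗ, adjoint_op]
  have h := (hA.conj_adjoint B).toLinearMap.trace_nonneg
  refine h.trans_eq ?_
  have hcyc : LinearMap.trace ℂ H
      ((B ∘L A ∘L ContinuousLinearMap.adjoint B : H →L[ℂ] H) : H →ₗ[ℂ] H) =
      LinearMap.trace ℂ H
        ((A ∘L (ContinuousLinearMap.adjoint B ∘L B) : H →L[ℂ] H) : H →ₗ[ℂ] H) :=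
    LinearMap.trace_mul_comm ℂ (B : H →ₗ[ℂ] H)
      ((A ∘L ContinuousLinearMap.adjoint B : H →L[ℂ] H) : H →ₗ[ℂ] H)
  rw [hcyc, hB]
  have hexp : A ∘L ((∑ i, conj (ξ i) • D.op (g i)⁻¹) ∘L B) =
      ∑ i, ∑ j, (conj (ξ i) * ξ j) • (A ∘L D.op ((g i)⁻¹ * g j)) := by
    ext v
    simp only [B, ContinuousLinearMap.comp_apply, sum_apply, smul_apply, map_sum, map_smul,
      Finset.smul_sum, mul_smul, op_mul]
    rw [Finset.sum_comm]
    exact Finset.sum_congr rfl fun i _ => Finset.sum_congr rfl fun j _ => smul_comm _ _ _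
  rw [hexp]
  simp only [ContinuousLinearMap.toLinearMap_sum, ContinuousLinearMap.toLinearMap_smul, map_sum, map_smul,
    smul_eq_mul]
  exact Finset.sum_congr rfl fun i _ => Finset.sum_congr rfl fun j _ => by ring

end IrredUnitaryRep

theorem IsPositiveDefiniteFun.const_mul {G : Type*} [Group G] {φ : G → ℂ}
    (h : IsPositiveDefiniteFun φ) {c : ℂ} (hc : 0 ≤ c) :
    IsPositiveDefiniteFun fun g => c * φ g := fun m g ξ => by
  simpa only [Finset.mul_sum, mul_assoc] using mul_nonneg hc (h m g ξ)

theorem mainTheorem9 {G : Type*} [Group G] [TopologicalSpace G] [IsTopologicalGroup G]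
    [CompactSpace G] [MeasurableSpace G] [BorelSpace G]
    (μ : Measure G) [μ.IsHaarMeasure] [IsProbabilityMeasure μ]
    {H : Type*} [NormedAddCommGroup H] [InnerProductSpace ℂ H] [FiniteDimensional ℂ H]
    (D : IrredUnitaryRep G H)
    (φ : G → ℂ) (hcont : Continuous φ) (hpos : IsPositiveDefiniteFun φ) :
    (D.fourierCoeff μ φ).IsPositive ∧ IsPositiveDefiniteFun (D.component μ φ) := by
  have hA := D.fourierCoeff_isPositive μ hcont hpos
  exact ⟨hA, (D.isPositiveDefiniteFun_trace_comp_op hA).const_mul (by simp)⟩
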